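/- Let $G$ be a connected (finite-dimensional, real) Lie group with identity $e$ and Lie algebra $\mathfrak g=T_eG$. Let $U\subset\mathbb R^m$ be a compact neighborhood of $0$ with $U\subset\overline{\operatorname{int}U}$, and let $f:U\times G\to G$, $f_u:=f(u,\cdot)$, define the discrete-time linear system $g_{k+1}=f(u_k,g_k)$, that is: - $f(u,g)=f(u,e)\,f(0,g)$ for all $u\in U$, $g\in G$; - $f_0$ is a (smooth) automorphism of the Lie group $G$; - $F:U\to G$, $F(u):=f(u,e)$, is continuous on $U$ and continuously differentiable on $\operatorname{int}U$ (for instance, $f$ extends to a $C^\infty$ map on $\hat U\times G$ for some open $\hat U\supset U$). Let $\mathcal U=\prod_{i\in\mathbb Z}U$; for $u\in\mathcal U$ and $x\in G$ put $\varphi(0,x,u)=x$ and $\varphi(k,x,u)=f_{u_{k-1}}\circ\dots\circ f_{u_0}(x)$ for $k\ge 1$. Let $\mathcal R(x)=\{\varphi(k,x,u): k\ge1,\ u\in\mathcal U\}$, $\mathcal C(x)=\{y\in G:\varphi(k,y,u)=x\text{ for some }k\ge1,\ u\in\mathcal U\}$, $\mathcal R=\mathcal R(e)$ and $\mathcal C=\mathcal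 C(e)$. A *control set* is a set $D\subset G$ that is maximal with respect to inclusion among the sets with the following two properties: (i) for every $x\in D$ there is $u\in\mathcal U$ with $\varphi(k,x,u)\in D$ for all $k\ge1$; (ii) $D\subset\overline{\mathcal R(x)}$ for every $x\in D$. Let $\hat dF_0=d(R_{F(0)^{-1}})_{F(0)}\circ dF_0:\mathbb R^m\to\mathfrak g$, where $R_g$ is right translation by $g$, and let $\boldsymbol\psi=d(f_0)_e:\mathfrak g\to\mathfrak g$. Suppose that the system satisfies the *ad-rank condition*: the smallest $\boldsymbol\psi$-invariant linear subspace of $\mathfrak g$ containing the image of $\hat dF_0$ is $\mathfrak g$ itself. Then there is a control set $D$ with $e\in\operatorname{int}D$ (in particular $\operatorname{int} D\neq\emptyset$), and $D=\overline{\mathcal R}\cap\mathcal C$. -/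

import Mathlib

open Set Filter Topology
open scoped Manifold ContDiff

noncomputable section

namespace DiscreteLinear

variable {m : ℕ} {E : Type*} [NormedAddCommGroup E] [NormedSpace ℝ E]
  {G : Type*} [TopologicalSpace G] [ChartedSpace E G] [Group G]

/-- `ψ : G → G` is an automorphism of the Lie group `G`: a smooth diffeomorphism of `G` that is
multiplicative. -/
def IsLieAutomorphism (E : Type*) [NormedAddCommGroup E] [NormedSpace ℝ E]
    {G : Type*} [TopologicalSpace G] [ChartedSpace E G] [Group G] (ψ : G → G) : Prop :=
  (∃ Φ : Diffeomorph 𝓘(ℝ, E) 𝓘(ℝ, E) G G ∞, ⇑Φ = ψ) ∧ ∀ g h : G, ψ (g * h) = ψ g * ψ h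

/-- A discrete-time linear control system `g_{k+1} = f (u_k, g_k)` on the Lie group `G`, with
control range `U ⊆ ℝ^m`.

Only the values of `f u` for `u ∈ U` matter; `f` is a total function for convenience.
The map `u ↦ f (u, e)` is continuous on `U` and continuously differentiable on `int U`; this holds
in particular if `f` is smooth on `Û × G` for an open set `Û ⊇ U`. -/
structure LinearSystem (m : ℕ) (E : Type*) [NormedAddCommGroup E] [NormedSpace ℝ E]
    (G : Type*) [TopologicalSpace G] [ChartedSpace E G] [Group G] where
  /-- the control range -/
  U : Set (EuclideanSpace ℝ (Fin m))
  /-- the right-hand side of the system -/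
  f : EuclideanSpace ℝ (Fin m) → G → G
  isCompact_U : IsCompact U
  U_mem_nhds : U ∈ 𝓝 (0 : EuclideanSpace ℝ (Fin m))
  U_subset_closure_interior : U ⊆ closure (interior U)
  f_eq_mul : ∀ u ∈ U, ∀ g : G, f u g = f u 1 * f 0 g
  f_zero_automorphism : IsLieAutomorphism E (f 0)
  continuousOn_f_one : ContinuousOn (fun u => f u 1) U
  contMDiffOn_f_one :
    ContMDiffOn 𝓘(ℝ, EuclideanSpace ℝ (Fin m)) 𝓘(ℝ, E) 1 (fun u => f u 1) (interior U)

namespace LinearSystem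

variable (S : LinearSystem m E G)

/-- The space `∏_{i ∈ ℤ} U` of control sequences. -/
abbrev Control : Type := ℤ → S.U

/-- The solution `φ(k, x, u) = f_{u_{k-1}} ∘ ⋯ ∘ f_{u_0} (x)` at times `k ≥ 0` (negative times do
not enter the notions below). -/
def solution : ℕ → G → S.Control → G
  | 0, x, _ => x
  | k + 1, x, u => S.f (u k) (solution k x u)

/-- `R_k(x)`: the points reachable from `x` at time `k`. -/
def reachableAt (k : ℕ) (x : G) : Set G := {y | ∃ u : S.Control, S.solution k x u = y}

/-- `C_k(x)`: the points that can be steered to `x` at time `k`. -/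
def controllableAt (k : ℕ) (x : G) : Set G := {y | ∃ u : S.Control, S.solution k y u = x}

/-- The reachable set `R(x) = ⋃_{k ≥ 1} R_k(x)`. -/
def reachable (x : G) : Set G := ⋃ (k : ℕ) (_ : 1 ≤ k), S.reachableAt k x

/-- The controllable set `C(x) = ⋃_{k ≥ 1} C_k(x)`. -/
def controllable (x : G) : Set G := ⋃ (k : ℕ) (_ : 1 ≤ k), S.controllableAt k x

/-- The first two properties of a control set: `D` is viable under the system, and every point of
`D` can be approximately steered to every point of `D`. -/
def IsPreControlSet (D : Set G) : Prop :=
  (∀ x ∈ D, ∃ u : S.Control, ∀ k : ℕ, 1 ≤ k → S.solution k x u ∈ D) ∧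
    ∀ x ∈ D, D ⊆ closure (S.reachable x)

/-- A control set is a maximal set (for inclusion) with the two properties above. -/
def IsControlSet (D : Set G) : Prop := Maximal S.IsPreControlSet D

/-- The map `F(u) = f(u, e)`. -/
def F (u : EuclideanSpace ℝ (Fin m)) : G := S.f u 1

/-- The derivative `d̂F_x = d(R_{F(x)⁻¹})_{F(x)} ∘ dF_x : ℝ^m → 𝔤` of a map `F : ℝ^m → G`, where the
tangent vectors of `G` are brought back to `𝔤 = T_e G` by right translations. -/
def hatDeriv (F : EuclideanSpace ℝ (Fin m) → G) (x : EuclideanSpace ℝ (Fin m)) :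
    EuclideanSpace ℝ (Fin m) →L[ℝ] GroupLieAlgebra 𝓘(ℝ, E) G :=
  (mfderiv 𝓘(ℝ, E) 𝓘(ℝ, E) (fun h : G => h * (F x)⁻¹) (F x)).comp
    (mfderiv 𝓘(ℝ, EuclideanSpace ℝ (Fin m)) 𝓘(ℝ, E) F x)

/-- The infinitesimal automorphism `d(f_0)_e : 𝔤 → 𝔤` of the automorphism `f_0` (which fixes
`e`). -/
def infinitesimal : GroupLieAlgebra 𝓘(ℝ, E) G →L[ℝ] GroupLieAlgebra 𝓘(ℝ, E) G :=
  mfderiv 𝓘(ℝ, E) 𝓘(ℝ, E) (S.f 0) (1 : G)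

/-- The ad-rank condition: the smallest subspace of `𝔤` that is invariant under the infinitesimal
automorphism and contains the image of `d̂F_0` is `𝔤`. -/
def AdRank : Prop :=
  sInf {W : Submodule ℝ (GroupLieAlgebra 𝓘(ℝ, E) G) |
    (∀ v : EuclideanSpace ℝ (Fin m), hatDeriv S.F 0 v ∈ W) ∧
      ∀ X ∈ W, S.infinitesimal X ∈ W} = ⊤

end LinearSystem

end DiscreteLinear

end

/-!
The solution starting at `x` is the solution starting at `e` multiplied by `f_0^k x`
(`solution_eq_mul`), so the whole question reduces to the endpoint maps at `e`. These are `C^1` near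
the zero control, and their derivative there is the endpoint map of the linear system
`x_{k+1} = A v_k + ψ x_k` on the Lie algebra, where `A = d̂F_0` and `ψ = d(f_0)_e`
(`exists_hasMFDerivAt_endpoint`). The reachable subspaces of this linear system increase and hence
stabilize at a `ψ`-invariant subspace containing the range of `A`; by the ad-rank condition this is
the whole Lie algebra (`exists_surjective_linearEndpoint`). So some endpoint map is a submersion at
the zero control, and some `R_k` with `k ≥ 1` is a neighbourhood of `e`
(`exists_reachableAt_mem_nhds`). Since `C_k` is the preimage of `R_k` under `y ↦ (f_0^k y)⁻¹`, the
controllable set is a neighbourhood of `e` as well (`controllable_one_mem_nhds`).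

The rest is a formal consequence. Every point of `D = cl R ∩ C` can be steered to `e`, and from
there approximately to every point of `cl R`; it stays in `D` on the way to `e`, and the zero
control then keeps it at `e`. Maximality of `D` follows from `C` being a neighbourhood of `e`
(`isControlSet_closure_reachable_inter_controllable`).
-/

namespace DiscreteLinear

/-! ### Linear control systems -/

section Linear

variable {K X V : Type*} [Field K] [AddCommGroup X] [Module K X] [AddCommGroup V] [Module K V]

/-- The endpoint at time `k` of the solution of the linear control system
`x_{k+1} = A v_k + ψ x_k`, `x_0 = 0`, as a linear map of the control sequence `v`. -/
def linearEndpoint (A : X →ₗ[K] V) (ψ : V →ₗ[K] V) : ℕ → (ℕ → X) →ₗ[K] V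
  | 0 => 0
  | k + 1 => A ∘ₗ LinearMap.proj k + ψ ∘ₗ linearEndpoint A ψ k

variable (A : X →ₗ[K] V) (ψ : V →ₗ[K] V)

lemma linearEndpoint_succ_apply (k : ℕ) (v : ℕ → X) :
    linearEndpoint A ψ (k + 1) v = A (v k) + ψ (linearEndpoint A ψ k v) := rfl

lemma linearEndpoint_congr {k : ℕ} {v w : ℕ → X} (h : ∀ i < k, v i = w i) :
    linearEndpoint A ψ k v = linearEndpoint A ψ k w := by
  induction k with
  | zero => rfl
  | succ k ih =>
    rw [linearEndpoint_succ_apply, linearEndpoint_succ_apply, h k k.lt_succ_self,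
      ih fun i hi => h i (hi.trans k.lt_succ_self)]

lemma range_linearEndpoint_succ (k : ℕ) :
    LinearMap.range (linearEndpoint A ψ (k + 1)) =
      LinearMap.range A ⊔ (LinearMap.range (linearEndpoint A ψ k)).map ψ := by
  apply le_antisymm
  · rintro _ ⟨v, rfl⟩
    exact Submodule.add_mem_sup ⟨v k, rfl⟩ ⟨_, ⟨v, rfl⟩, rfl⟩
  · intro y hy
    obtain ⟨_, ⟨a, rfl⟩, _, ⟨_, ⟨v, rfl⟩, rfl⟩, rfl⟩ := Submodule.mem_sup.1 hy
    refine ⟨Function.update v k a, ?_⟩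
    rw [linearEndpoint_succ_apply, Function.update_self,
      linearEndpoint_congr A ψ fun i hi => Function.update_of_ne hi.ne a v]

lemma monotone_range_linearEndpoint :
    Monotone fun k => LinearMap.range (linearEndpoint A ψ k) := by
  refine monotone_nat_of_le_succ fun k => ?_
  induction k with
  | zero =>
    have h : LinearMap.range (linearEndpoint A ψ 0) = ⊥ := LinearMap.range_zero
    rw [h]
    exact bot_le
  | succ k ih =>
    rw [range_linearEndpoint_succ, range_linearEndpoint_succ A ψ (k + 1)]
    exact sup_le_sup_left (Submodule.map_mono ih) _

/-- The reachable subspaces of a linear system increase with time, so they stabilize at a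
`ψ`-invariant subspace containing the range of `A`. -/
theorem exists_surjective_linearEndpoint [FiniteDimensional K V]
    (h : sInf {W : Submodule K V | (∀ v, A v ∈ W) ∧ ∀ x ∈ W, ψ x ∈ W} = ⊤) :
    ∃ d, Function.Surjective (linearEndpoint A ψ (d + 1)) := by
  obtain ⟨d, hd⟩ := monotone_stabilizes_iff_noetherian.2 (inferInstance : IsNoetherian K V)
    ⟨_, monotone_range_linearEndpoint A ψ⟩
  have hd : LinearMap.range (linearEndpoint A ψ (d + 1)) =
      LinearMap.range A ⊔ (LinearMap.range (linearEndpoint A ψ (d + 1))).map ψ := by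
    rw [← range_linearEndpoint_succ]
    exact (hd (d + 1) d.le_succ).symm.trans (hd (d + 2) (by omega))
  refine ⟨d, LinearMap.range_eq_top.1 (top_le_iff.1 (h ▸ sInf_le ⟨fun v => ?_, fun x hx => ?_⟩))⟩
  · rw [hd]
    exact Submodule.mem_sup_left ⟨v, rfl⟩
  · rw [hd]
    exact Submodule.mem_sup_right ⟨x, hx, rfl⟩

end Linear

/-! ### First-order calculus on Lie groups -/

section Calculus

variable {X : Type*} [NormedAddCommGroup X] [NormedSpace ℝ X]
  {E : Type*} [NormedAddCommGroup E] [NormedSpace ℝ E]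
  {G : Type*} [TopologicalSpace G] [ChartedSpace E G]

/-- The derivative of the multiplication of a Lie group at the identity is addition. -/
lemma hasMFDerivAt_mul_of_eq_one [Group G] [LieGroup 𝓘(ℝ, E) ∞ G] {a b : X → G} {x : X}
    {a' b' : X →L[ℝ] E} (ha : HasMFDerivAt 𝓘(ℝ, X) 𝓘(ℝ, E) a x a')
    (hb : HasMFDerivAt 𝓘(ℝ, X) 𝓘(ℝ, E) b x b') (ha1 : a x = 1) (hb1 : b x = 1) :
    HasMFDerivAt 𝓘(ℝ, X) 𝓘(ℝ, E) (fun y => a y * b y) x (a' + b') := by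
  have hmul : MDifferentiableAt (𝓘(ℝ, E).prod 𝓘(ℝ, E)) 𝓘(ℝ, E)
      (fun p : G × G => p.1 * p.2) (a x, b x) :=
    (contMDiff_mul 𝓘(ℝ, E) ∞).mdifferentiableAt (by simp)
  have h := hmul.hasMFDerivAt.comp x (ha.prodMk hb)
  refine h.congr_mfderiv (ContinuousLinearMap.ext fun v => ?_)
  have h2 := mfderiv_prod_eq_add_apply (v := ((a' v, b' v) : E × E)) hmul
  have e1 : (fun z : G => z * b x) = id := by funext z; simp [hb1]
  have e2 : (fun z : G => a x * z) = id := by funext z; simp [ha1]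
  dsimp only at h2
  rw [e1, e2, mfderiv_id, mfderiv_id] at h2
  exact h2

/-- A `C^1` map into a manifold whose derivative at a point is surjective is open at that point. -/
lemma map_nhds_eq_of_surjective_hasMFDerivAt [CompleteSpace X] [FiniteDimensional ℝ E]
    {Φ : X → G} {x : X}
    {Φ' : X →L[ℝ] E} (hΦ : ContMDiffAt 𝓘(ℝ, X) 𝓘(ℝ, E) 1 Φ x)
    (hΦ' : HasMFDerivAt 𝓘(ℝ, X) 𝓘(ℝ, E) Φ x Φ') (hsurj : Function.Surjective Φ') :
    map Φ (𝓝 x) = 𝓝 (Φ x) := by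
  have : CompleteSpace E := FiniteDimensional.complete ℝ E
  have hc := (contMDiffAt_iff_target.1 hΦ).2.contDiffAt
  have hd : HasFDerivAt (extChartAt 𝓘(ℝ, E) (Φ x) ∘ Φ) Φ' x := by
    have h := hΦ'.2
    simp only [writtenInExtChartAt, extChartAt_model_space_eq_id, modelWithCornersSelf_coe,
      range_id] at h
    exact hasFDerivWithinAt_univ.1 h
  have hm := (hc.hasStrictFDerivAt' hd one_ne_zero).map_nhds_eq_of_surj
    (LinearMap.range_eq_top.2 hsurj)
  have hsrc : ∀ᶠ y in 𝓝 x, Φ y ∈ (extChartAt 𝓘(ℝ, E) (Φ x)).source :=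
    hΦ.continuousAt (extChartAt_source_mem_nhds (Φ x))
  have h1 : map Φ (𝓝 x) =
      map (extChartAt 𝓘(ℝ, E) (Φ x)).symm (map (extChartAt 𝓘(ℝ, E) (Φ x) ∘ Φ) (𝓝 x)) := by
    rw [map_map]
    refine map_congr ?_
    filter_upwards [hsrc] with y hy
    exact ((extChartAt 𝓘(ℝ, E) (Φ x)).left_inv hy).symm
  rw [h1, hm]
  simpa using map_extChartAt_symm_nhdsWithin_range (I := 𝓘(ℝ, E)) (Φ x)

end Calculus

namespace LinearSystem

variable {m : ℕ} {E : Type*} [NormedAddCommGroup E] [NormedSpace ℝ E]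
  {G : Type*} [TopologicalSpace G] [ChartedSpace E G] [Group G] (S : LinearSystem m E G)

/-! ### Solutions, reachable sets and controllable sets -/

lemma zero_mem_U : (0 : EuclideanSpace ℝ (Fin m)) ∈ S.U := mem_of_mem_nhds S.U_mem_nhds

lemma f_zero_mul (g h : G) : S.f 0 (g * h) = S.f 0 g * S.f 0 h := S.f_zero_automorphism.2 g h

lemma f_zero_one : S.f 0 1 = 1 := map_one (MonoidHom.mk' (S.f 0) S.f_zero_mul)

lemma contMDiff_f_zero : ContMDiff 𝓘(ℝ, E) 𝓘(ℝ, E) ∞ (S.f 0) := by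
  obtain ⟨Φ, hΦ⟩ := S.f_zero_automorphism.1
  exact hΦ ▸ Φ.contMDiff

lemma continuous_f [IsTopologicalGroup G] {u : EuclideanSpace ℝ (Fin m)} (hu : u ∈ S.U) :
    Continuous (S.f u) := by
  have h : S.f u = fun g => S.f u 1 * S.f 0 g := funext (S.f_eq_mul u hu)
  rw [h]
  exact continuous_const.mul S.contMDiff_f_zero.continuous

lemma solution_succ (k : ℕ) (x : G) (u : S.Control) :
    S.solution (k + 1) x u = S.f (u k) (S.solution k x u) := rfl

lemma solution_congr {k : ℕ} {u v : S.Control} (x : G) (h : ∀ i : ℕ, i < k → u i = v i) :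
    S.solution k x u = S.solution k x v := by
  induction k with
  | zero => rfl
  | succ k ih =>
    rw [solution_succ, solution_succ, h k k.lt_succ_self,
      ih fun i hi => h i (hi.trans k.lt_succ_self)]

lemma solution_add (j k : ℕ) (x : G) (u : S.Control) :
    S.solution (j + k) x u = S.solution k (S.solution j x u) fun i => u (j + i) := by
  induction k with
  | zero => rfl
  | succ k ih =>
    rw [← add_assoc, solution_succ, solution_succ, ih]
    push_cast
    rfl

/-- The solution starting at `x` is the solution starting at `e`, translated by the solution of
the uncontrolled system. -/
lemma solution_eq_mul (k : ℕ) (x : G) (u : S.Control) :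
    S.solution k x u = S.solution k 1 u * (S.f 0)^[k] x := by
  induction k with
  | zero => exact (one_mul x).symm
  | succ k ih =>
    rw [solution_succ, solution_succ, S.f_eq_mul _ (u k).2, S.f_eq_mul _ (u k).2 (S.solution k 1 u),
      ih, f_zero_mul, Function.iterate_succ_apply', mul_assoc]

/-- The control that follows `u` up to time `j` and then a copy of `v` that starts at time `j`. -/
def concat (j : ℕ) (u v : S.Control) : S.Control := fun i => if i < j then u i else v (i - j)

lemma solution_concat_of_le {i j : ℕ} (h : i ≤ j) (x : G) (u v : S.Control) :
    S.solution i x (S.concat j u v) = S.solution i x u :=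
  S.solution_congr x fun n hn => if_pos (by omega)

lemma solution_concat_add (j k : ℕ) (x : G) (u v : S.Control) :
    S.solution (j + k) x (S.concat j u v) = S.solution k (S.solution j x u) v := by
  rw [solution_add, S.solution_concat_of_le le_rfl]
  refine S.solution_congr _ fun n _ => ?_
  simp [concat]

/-- The control that is constantly `0`. -/
def zeroControl : S.Control := fun _ => ⟨0, S.zero_mem_U⟩

lemma solution_one_zeroControl (k : ℕ) : S.solution k 1 S.zeroControl = 1 := by
  induction k with
  | zero => rfl
  | succ k ih => rw [solution_succ, ih]; exact S.f_zero_one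

variable {S}

lemma mem_reachable {x y : G} :
    y ∈ S.reachable x ↔ ∃ k, 1 ≤ k ∧ ∃ u, S.solution k x u = y := by
  simp [reachable, reachableAt]

lemma mem_controllable {x y : G} : y ∈ S.controllable x ↔ x ∈ S.reachable y := by
  simp [controllable, controllableAt, mem_reachable]

lemma reachable_trans {x y z : G} (hxy : y ∈ S.reachable x) (hyz : z ∈ S.reachable y) :
    z ∈ S.reachable x := by
  obtain ⟨j, hj, u, rfl⟩ := mem_reachable.1 hxy
  obtain ⟨k, -, v, rfl⟩ := mem_reachable.1 hyz
  exact mem_reachable.2 ⟨j + k, by omega, S.concat j u v, S.solution_concat_add j k x u v⟩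

variable (S)

/-- The closure of a reachable set is forward invariant. -/
lemma solution_mem_closure_reachable [IsTopologicalGroup G] {x y : G}
    (hy : y ∈ closure (S.reachable x)) (k : ℕ) (u : S.Control) :
    S.solution k y u ∈ closure (S.reachable x) := by
  induction k with
  | zero => exact hy
  | succ k ih =>
    rw [solution_succ]
    refine map_mem_closure (S.continuous_f (u k).2) ih fun z hz => reachable_trans hz ?_
    exact mem_reachable.2 ⟨1, le_rfl, fun _ => u k, rfl⟩

/-! ### The control set around the identity -/

lemma isPreControlSet_closure_reachable_inter_controllable [IsTopologicalGroup G]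
    (hR : S.reachable 1 ∈ 𝓝 1) :
    S.IsPreControlSet (closure (S.reachable 1) ∩ S.controllable 1) := by
  have h1 : (1 : G) ∈ S.reachable 1 := mem_of_mem_nhds hR
  refine ⟨fun x ⟨hxR, hxC⟩ => ?_, fun x ⟨_, hxC⟩ y ⟨hyR, _⟩ =>
    closure_mono (fun z => reachable_trans (mem_controllable.1 hxC)) hyR⟩
  obtain ⟨k, -, u, hu⟩ := mem_reachable.1 (mem_controllable.1 hxC)
  refine ⟨S.concat k u S.zeroControl, fun n _ =>
    ⟨S.solution_mem_closure_reachable hxR n _, mem_controllable.2 ?_⟩⟩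
  rcases lt_or_ge n k with hn | hn
  · obtain ⟨j, rfl⟩ := Nat.exists_eq_add_of_lt hn
    rw [S.solution_concat_of_le hn.le]
    exact mem_reachable.2 ⟨j + 1, by omega, _, (S.solution_add n (j + 1) x u).symm.trans hu⟩
  · obtain ⟨j, rfl⟩ := Nat.exists_eq_add_of_le hn
    rw [solution_concat_add, hu, solution_one_zeroControl]
    exact h1

/-- If `e` is an interior point of both `R` and `C`, then `cl R ∩ C` is maximal: a point `y` of
a larger set with the same properties can be steered approximately to `e`, hence into the
neighbourhood `C` of `e`, hence to `e`. -/
theorem isControlSet_closure_reachable_inter_controllable [IsTopologicalGroup G]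
    (hR : S.reachable 1 ∈ 𝓝 1) (hC : S.controllable 1 ∈ 𝓝 1) :
    S.IsControlSet (closure (S.reachable 1) ∩ S.controllable 1) := by
  refine ⟨S.isPreControlSet_closure_reachable_inter_controllable hR, fun D' hD' hle y hy => ?_⟩
  have h1 : (1 : G) ∈ D' := hle ⟨subset_closure (mem_of_mem_nhds hR), mem_of_mem_nhds hC⟩
  refine ⟨hD'.2 1 h1 hy, mem_controllable.2 ?_⟩
  obtain ⟨z, hzC, hzy⟩ := mem_closure_iff_nhds.1 (hD'.2 y hy h1) _ hC
  exact reachable_trans hzy (mem_controllable.1 hzC)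

/-- The points that can be steered to `e` at time `k` are the points `y` with
`f_0^k y ∈ R_k⁻¹`. -/
lemma controllable_one_mem_nhds [IsTopologicalGroup G] {k : ℕ} (hk : 1 ≤ k)
    (h : S.reachableAt k 1 ∈ 𝓝 1) : S.controllable 1 ∈ 𝓝 1 := by
  have hcont : Continuous fun y => ((S.f 0)^[k] y)⁻¹ :=
    (S.contMDiff_f_zero.continuous.iterate k).inv
  have hone : ((S.f 0)^[k] 1)⁻¹ = 1 := by
    rw [Function.iterate_fixed S.f_zero_one, inv_one]
  have h' : S.reachableAt k 1 ∈ 𝓝 ((S.f 0)^[k] 1)⁻¹ := by rwa [hone]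
  filter_upwards [hcont.continuousAt.preimage_mem_nhds h'] with y ⟨u, hu⟩
  refine mem_controllable.2 (mem_reachable.2 ⟨k, hk, u, ?_⟩)
  rw [solution_eq_mul, hu, inv_mul_cancel]

/-! ### The endpoint map and its derivative -/

/-- The endpoint at time `k` of the solution starting at `e`, as a function of a control sequence
`ℕ → ℝ^m` that need not take values in the control range. -/
def endpoint : ℕ → (ℕ → EuclideanSpace ℝ (Fin m)) → G
  | 0, _ => 1
  | k + 1, v => S.F (v k) * S.f 0 (endpoint k v)

lemma solution_one_eq_endpoint (k : ℕ) (u : S.Control) :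
    S.solution k 1 u = S.endpoint k fun i => u i := by
  induction k with
  | zero => rfl
  | succ k ih => rw [solution_succ, S.f_eq_mul _ (u k).2, ih]; rfl

lemma F_zero : S.F 0 = 1 := S.f_zero_one

lemma endpoint_zero (k : ℕ) : S.endpoint k 0 = 1 := by
  induction k with
  | zero => rfl
  | succ k ih => simp [endpoint, ih, F_zero, f_zero_one]

lemma contMDiffAt_F :
    ContMDiffAt 𝓘(ℝ, EuclideanSpace ℝ (Fin m)) 𝓘(ℝ, E) 1 S.F 0 :=
  S.contMDiffOn_f_one.contMDiffAt (interior_mem_nhds.2 S.U_mem_nhds)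

/-- Since `F 0 = e`, the right translation in `d̂F_0` is the identity. -/
lemma hasMFDerivAt_F :
    HasMFDerivAt 𝓘(ℝ, EuclideanSpace ℝ (Fin m)) 𝓘(ℝ, E) S.F 0 (hatDeriv S.F 0) := by
  have h : (fun h : G => h * (S.F 0)⁻¹) = id := by funext h; simp [F_zero]
  have h2 : (hatDeriv S.F 0 : EuclideanSpace ℝ (Fin m) →L[ℝ] E) =
      mfderiv 𝓘(ℝ, EuclideanSpace ℝ (Fin m)) 𝓘(ℝ, E) S.F 0 := by
    unfold hatDeriv
    rw [h, mfderiv_id]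
    rfl
  rw [h2]
  exact (S.contMDiffAt_F.mdifferentiableAt one_ne_zero).hasMFDerivAt

section Endpoint

variable {X : Type*} [NormedAddCommGroup X] [NormedSpace ℝ X]
  (π : ℕ → X →L[ℝ] EuclideanSpace ℝ (Fin m))

variable [LieGroup 𝓘(ℝ, E) ∞ G]

lemma contMDiffAt_endpoint (k : ℕ) :
    ContMDiffAt 𝓘(ℝ, X) 𝓘(ℝ, E) 1 (fun x => S.endpoint k fun i => π i x) 0 := by
  have : LieGroup 𝓘(ℝ, E) 1 G := LieGroup.of_le (n := ∞) (by simp)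
  induction k with
  | zero => exact contMDiffAt_const
  | succ k ih =>
    have hπ : ContMDiffAt 𝓘(ℝ, X) 𝓘(ℝ, EuclideanSpace ℝ (Fin m)) 1 (π k) 0 :=
      (π k).contDiff.contDiffAt.contMDiffAt
    have hF := S.contMDiffAt_F.comp_of_eq hπ (map_zero (π k))
    exact hF.mul (((S.contMDiff_f_zero.of_le (by simp)).contMDiffAt).comp 0 ih)

/-- The derivative of the endpoint map at the zero control is the endpoint map of the linearized
system. -/
lemma exists_hasMFDerivAt_endpoint (k : ℕ) :
    ∃ L : X →L[ℝ] E,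
      HasMFDerivAt 𝓘(ℝ, X) 𝓘(ℝ, E) (fun x => S.endpoint k fun i => π i x) 0 L ∧
      ∀ x, L x = linearEndpoint (V := GroupLieAlgebra 𝓘(ℝ, E) G)
        (hatDeriv (E := E) S.F 0).toLinearMap S.infinitesimal.toLinearMap k (fun i => π i x) := by
  induction k with
  | zero => exact ⟨0, hasMFDerivAt_const _ _, fun x => rfl⟩
  | succ k ih =>
    obtain ⟨L, hL, hLx⟩ := ih
    have hzero : (S.endpoint k fun i => π i (0 : X)) = 1 := by
      simpa using! S.endpoint_zero k
    have hF : HasMFDerivAt 𝓘(ℝ, X) 𝓘(ℝ, E) (fun x => S.F (π k x)) 0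
        ((show EuclideanSpace ℝ (Fin m) →L[ℝ] E from hatDeriv S.F 0).comp (π k)) := by
      have hF0 : HasMFDerivAt 𝓘(ℝ, EuclideanSpace ℝ (Fin m)) 𝓘(ℝ, E) S.F (π k 0)
          (hatDeriv S.F 0) := by
        rw [map_zero]
        exact S.hasMFDerivAt_F
      exact hF0.comp 0 (π k).hasMFDerivAt
    have hf : HasMFDerivAt 𝓘(ℝ, X) 𝓘(ℝ, E) (fun x => S.f 0 (S.endpoint k fun i => π i x)) 0
        ((show E →L[ℝ] E from S.infinitesimal).comp L) := by
      have hf0 : HasMFDerivAt 𝓘(ℝ, E) 𝓘(ℝ, E) (S.f 0) (S.endpoint k fun i => π i (0 : X))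
          S.infinitesimal := by
        rw [hzero]
        exact (S.contMDiff_f_zero.mdifferentiableAt (by simp)).hasMFDerivAt
      exact hf0.comp 0 hL
    refine ⟨_, hasMFDerivAt_mul_of_eq_one hF hf ?_ ?_, fun x => ?_⟩
    · simp [F_zero]
    · simp only [hzero, f_zero_one]
    · rw [linearEndpoint_succ_apply, ← hLx]
      rfl

end Endpoint

/-- Under the ad-rank condition the endpoint map at a suitable time is a submersion at the zero
control, so its image contains a neighbourhood of `e`. -/
theorem exists_reachableAt_mem_nhds [FiniteDimensional ℝ E] [LieGroup 𝓘(ℝ, E) ∞ G]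
    (hS : S.AdRank) : ∃ k, 1 ≤ k ∧ S.reachableAt k 1 ∈ 𝓝 1 := by
  have : FiniteDimensional ℝ (GroupLieAlgebra 𝓘(ℝ, E) G) := ‹FiniteDimensional ℝ E›
  obtain ⟨d, hd⟩ := exists_surjective_linearEndpoint
    (hatDeriv (E := E) S.F 0).toLinearMap S.infinitesimal.toLinearMap hS
  -- The controls `v 0, …, v d`, continued by `0`, form a finite-dimensional space.
  let π : ℕ → (Fin (d + 1) → EuclideanSpace ℝ (Fin m)) →L[ℝ] EuclideanSpace ℝ (Fin m) :=
    fun i => if h : i < d + 1 then ContinuousLinearMap.proj ⟨i, h⟩ else 0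
  have hπ : ∀ i (h : i < d + 1) x, π i x = x ⟨i, h⟩ := fun i h x => by
    simp only [π, dif_pos h, ContinuousLinearMap.proj_apply]
  have hπ' : ∀ i, ¬ i < d + 1 → ∀ x, π i x = 0 := fun i h x => by
    simp only [π, dif_neg h, zero_apply]
  obtain ⟨L, hL, hLx⟩ := S.exists_hasMFDerivAt_endpoint π (d + 1)
  have hsurj : Function.Surjective L := fun w => by
    obtain ⟨v, hv⟩ := hd w
    have h := linearEndpoint_congr (hatDeriv (E := E) S.F 0).toLinearMap
      S.infinitesimal.toLinearMap (k := d + 1)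
      (v := fun i => π i fun j => v j) (w := v) fun i hi => hπ i hi _
    exact ⟨fun i => v i, (hLx _).trans (h.trans hv)⟩
  have hzero : (S.endpoint (d + 1) fun i => π i 0) = 1 := by
    simpa using! S.endpoint_zero (d + 1)
  have hmap := map_nhds_eq_of_surjective_hasMFDerivAt (S.contMDiffAt_endpoint π (d + 1)) hL hsurj
  rw [hzero] at hmap
  have hU : ∀ᶠ x in 𝓝 (0 : Fin (d + 1) → EuclideanSpace ℝ (Fin m)), ∀ i, x i ∈ S.U :=
    eventually_all.2 fun i => (continuous_apply i).continuousAt S.U_mem_nhds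
  refine ⟨d + 1, by omega, ?_⟩
  rw [← hmap]
  filter_upwards [image_mem_map hU] with _ ⟨x, hx, hxy⟩
  have hx' : ∀ i, π i x ∈ S.U := fun i => by
    by_cases h : i < d + 1
    · exact hπ i h x ▸ hx _
    · exact hπ' i h x ▸ S.zero_mem_U
  refine ⟨fun i => ⟨π i.toNat x, hx' _⟩, ?_⟩
  rw [solution_one_eq_endpoint, ← hxy]
  simp only [Int.toNat_natCast]

end LinearSystem

end DiscreteLinear

theorem mainTheorem4 {m : ℕ}
    {E : Type*} [NormedAddCommGroup E] [NormedSpace ℝ E] [FiniteDimensional ℝ E]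
    {G : Type*} [TopologicalSpace G] [ChartedSpace E G] [Group G]
    [LieGroup 𝓘(ℝ, E) ∞ G] [ConnectedSpace G]
    (S : DiscreteLinear.LinearSystem m E G) (hS : S.AdRank) :
    ∃ D : Set G, S.IsControlSet D ∧ (1 : G) ∈ interior D ∧
      D = closure (S.reachable 1) ∩ S.controllable 1 := by
  have : IsTopologicalGroup G := topologicalGroup_of_lieGroup 𝓘(ℝ, E) ∞
  obtain ⟨k, hk, hRk⟩ := S.exists_reachableAt_mem_nhds hS
  have hR : S.reachable 1 ∈ 𝓝 1 :=
    mem_of_superset hRk fun y hy => DiscreteLinear.LinearSystem.mem_reachable.2 ⟨k, hk, hy⟩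
  have hC := S.controllable_one_mem_nhds hk hRk
  exact ⟨_, S.isControlSet_closure_reachable_inter_controllable hR hC,
    mem_interior_iff_mem_nhds.2 (inter_mem (mem_of_superset hR subset_closure) hC), rfl⟩
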